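/- Let $G$ be a locally compact second countable Hausdorff group, "almost all" in $G$ referring to Haar measure. Let $X$ be a $G$-Borel space, i.e. a Borel space with a $G$-action such that $(g,x)\mapsto g\cdot x$ is Borel. Let $m:G\times G\to\mathbf T$ be a multiplier, i.e. a Borel map into the complex numbers of modulus $1$ with $m(e,g)=m(g,e)=1$ and $m(ab,c)\,m(a,b)=m(a,bc)\,m(b,c)$. Let $\mathcal K$ be a separable complex Hilbert space, $\mathcal U(\mathcal K)$ its unitary group with the (weak $=$ strong operator) Borel structure, $\mathcal C$ a $G$-invariant measure class on $X$ and $\alpha\in\mathcal C$ a $\sigma$-finite measure such that $\mathcal H=L^2(X,\mathcal K,\alpha)$ is separable. An $m$-$(G,X,\mathcal U(\mathcal K))$-cocycle relative to $\mathcal C$ is a Borel map $\phi:G\times X\to\mathcal U(\mathcal K)$ with $\phi(e,x)=\mathbf 1$ for almost all $x$ and $\phi(g_1g_2,x)=m(g_1,g_2)\,\phi(g_1,g_2\cdot x)\,\phi(g_2,x)$ for almost all $(g_1,g_2,x)\in G\times G\times X$. Two cocycles $\phi,\phi'$ are cohomologous if there is a Borel map $b:X\to\mathcal U(\mathcal K)$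 with $\phi'(g,x)=b(g\cdot x)\,\phi(g,x)\,b(x)^{-1}$ for almost all $(g,x)$. An $m$-system of imprimitivity for $G$ based on $X$ and acting in a Hilbert space is a pair $(U,P)$ of a Borel map $g\mapsto U_g$ into its unitary group with $U_{g_1g_2}=m(g_1,g_2)U_{g_1}U_{g_2}$ for all $g_1,g_2$, and a projection valued measure $E\mapsto P_E$ on the Borel sets of $X$, with $U_gP_EU_g^{-1}=P_{g\cdot E}$ for all $g\in G$ and all Borel $E\subset X$. Two such systems are equivalent if a unitary operator between their Hilbert spaces intertwines both the $U_g$ and the $P_E$. For each $g\in G$ let $r_g$ be a Borel function which is a version of the Radon–Nikodym derivative $d\alpha/d\alpha^{g^{-1}}$, where $\alpha^{g^{-1}}(E)=\alpha(g\cdot E)$, and let $\phi$ be an $m$-$(G,X,\mathcal U(\mathcal K))$-cocycle relative to $\mathcal C$. Then there exists a unique $m$-system of imprimitivity $(U,P)$ acting in $\mathcal H$ such that $$P_Ef=\chi_E f\qquad\text{for all Borel }E\subset X,\ f\in\mathcal H,$$ and, for almost all $g\in G$, $$(U_gf)(x)=\{r_g(g^{-1}\cdot x)\}^{1/2}\,\phi(g,g^{-1}\cdot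 x)\,f(g^{-1}\cdot x)\qquad\text{for all } f\in\mathcal H\text{ and almost all }x\in X.$$ Moreover, the equivalence class of $(U,P)$ depends only on the measure class $\mathcal C$ and on the cohomology class of $\phi$: if $\alpha'\in\mathcal C$ is another $\sigma$-finite measure, $r'_g$ are versions of $d\alpha'/d\alpha'^{\,g^{-1}}$, and $\phi'$ is a cocycle relative to $\mathcal C$ cohomologous to $\phi$, then the system acting in $L^2(X,\mathcal K,\alpha')$ obtained in this way from $\alpha'$, $r'$, $\phi'$ is equivalent to $(U,P)$. -/

import Mathlib

open MeasureTheory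

/-- The Borel structure on the unitary group `𝒰(H)` of a Hilbert space: the smallest σ-algebra
making all matrix coefficients `u ↦ ⟪v, u w⟫` measurable. For separable `H` it is the Borel
σ-algebra of the strong (equivalently, the weak) operator topology. -/
noncomputable instance unitaryBorel (H : Type*) [NormedAddCommGroup H] [InnerProductSpace ℂ H] :
    MeasurableSpace (H ≃ₗᵢ[ℂ] H) :=
  ⨆ (v : H) (w : H), MeasurableSpace.comap
    (fun u : H ≃ₗᵢ[ℂ] H => @inner ℂ H InnerProductSpace.toInner v (u w))
    (inferInstance : MeasurableSpace ℂ)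

/-- Multipliers of a Borel group `G`, normalised Borel `𝕋`-valued 2-cocycles. -/
structure IsMultiplier {G : Type*} [Group G] [MeasurableSpace G] (m : G → G → Circle) : Prop where
  measurable : Measurable (fun p : G × G => (m p.1 p.2 : ℂ))
  one_left : ∀ g, m 1 g = 1
  one_right : ∀ g, m g 1 = 1
  assoc : ∀ a b c, m (a * b) c * m a b = m a (b * c) * m b c

/-- `m`-representations `U` of `G` in `H`: Borel maps into the unitary group with
`U (g₁ g₂) = m (g₁, g₂) U g₁ U g₂`. -/
structure IsMRepresentation {G : Type*} [Group G] [MeasurableSpace G] (m : G → G → Circle)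
    {H : Type*} [NormedAddCommGroup H] [InnerProductSpace ℂ H] (U : G → H ≃ₗᵢ[ℂ] H) : Prop where
  measurable : Measurable U
  map_mul : ∀ g₁ g₂ v, U (g₁ * g₂) v = (m g₁ g₂ : ℂ) • U g₁ (U g₂ v)

/-- The Borel subsets of `X`. -/
abbrev BorelSubset (X : Type*) [MeasurableSpace X] : Type _ := {E : Set X // MeasurableSet E}

/-- Projection valued measures based on `X` and acting in `H`. -/
structure IsProjectionValuedMeasure {X : Type*} [MeasurableSpace X]
    {H : Type*} [NormedAddCommGroup H] [InnerProductSpace ℂ H] [CompleteSpace H]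
    (P : BorelSubset X → H →L[ℂ] H) : Prop where
  isStarProjection : ∀ E, IsStarProjection (P E)
  empty : P ⟨∅, MeasurableSet.empty⟩ = 0
  univ : P ⟨Set.univ, MeasurableSet.univ⟩ = 1
  inter : ∀ E F : BorelSubset X, P ⟨E.1 ∩ F.1, E.2.inter F.2⟩ = P E * P F
  iUnion : ∀ E : ℕ → BorelSubset X, Pairwise (fun i j => Disjoint (E i).1 (E j).1) →
    ∀ v : H, HasSum (fun n => P (E n) v) (P ⟨⋃ n, (E n).1, MeasurableSet.iUnion fun n => (E n).2⟩ v)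

/-- The translate `g · E` of a Borel set `E`. -/
def BorelSubset.translate {G X : Type*} [Group G] [MeasurableSpace G] [MeasurableSpace X]
    [MulAction G X] [MeasurableSMul₂ G X] (g : G) (E : BorelSubset X) : BorelSubset X :=
  ⟨(fun x => g • x) '' E.1, (MeasurableEquiv.smul g).measurableEmbedding.measurableSet_image.2 E.2⟩

/-- `m`-systems of imprimitivity `(U, P)` for `G` based on `X` and acting in `H`; the relation
`U g P_E (U g)⁻¹ = P_{g · E}` is `imprimitivity`. -/
structure MSystemOfImprimitivity {G : Type*} [Group G] [MeasurableSpace G] (m : G → G → Circle)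
    (X : Type*) [MeasurableSpace X] [MulAction G X] [MeasurableSMul₂ G X]
    (H : Type*) [NormedAddCommGroup H] [InnerProductSpace ℂ H] [CompleteSpace H] where
  U : G → H ≃ₗᵢ[ℂ] H
  P : BorelSubset X → H →L[ℂ] H
  isMRepresentation : IsMRepresentation m U
  isProjectionValuedMeasure : IsProjectionValuedMeasure P
  imprimitivity : ∀ (g : G) (E : BorelSubset X) (v : H),
    U g (P E ((U g)⁻¹ v)) = P (E.translate g) v

/-- Unitary equivalence of two `m`-systems of imprimitivity. -/
def MSystemOfImprimitivity.Equivalent {G : Type*} [Group G] [MeasurableSpace G]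
    {m : G → G → Circle} {X : Type*} [MeasurableSpace X] [MulAction G X] [MeasurableSMul₂ G X]
    {H H' : Type*} [NormedAddCommGroup H] [InnerProductSpace ℂ H] [CompleteSpace H]
    [NormedAddCommGroup H'] [InnerProductSpace ℂ H'] [CompleteSpace H']
    (S : MSystemOfImprimitivity m X H) (S' : MSystemOfImprimitivity m X H') : Prop :=
  ∃ W : H ≃ₗᵢ[ℂ] H', (∀ g v, W (S.U g v) = S'.U g (W v)) ∧ (∀ E v, W (S.P E v) = S'.P E (W v))

/-- The measure class of `α` is `G`-invariant. (Applying the condition to `g⁻¹` gives the reverse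
absolute continuity, so that `α` and its translates have the same null sets.) -/
def HasInvariantClass (G : Type*) [Group G] {X : Type*} [MeasurableSpace X] [MulAction G X]
    (α : Measure X) : Prop :=
  ∀ g : G, α.map (fun x => g • x) ≪ α

/-- For each `g`, `r g` is a Borel version of the Radon–Nikodym derivative `dα / dα^{g⁻¹}`, where
`α^g (E) = α (g⁻¹ · E)`, i.e. `α^{g⁻¹}` is the image of `α` under `x ↦ g⁻¹ · x`. -/
def IsRadonNikodymFamily {G : Type*} [Group G] {X : Type*} [MeasurableSpace X] [MulAction G X]
    (α : Measure X) (r : G → X → NNReal) : Prop :=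
  ∀ g : G, Measurable (r g) ∧
    α = (α.map (fun x => g⁻¹ • x)).withDensity (fun x => (r g x : ENNReal))

/-- `m-(G, X, 𝒰(K))`-cocycles relative to the measure class of `α`; "almost all" in `G` refers to
the measure `μ`, which will be a Haar measure. -/
structure IsMCocycle {G : Type*} [Group G] [MeasurableSpace G] (μ : Measure G)
    (m : G → G → Circle) {X : Type*} [MeasurableSpace X] [MulAction G X] (α : Measure X)
    {K : Type*} [NormedAddCommGroup K] [InnerProductSpace ℂ K]
    (φ : G × X → (K ≃ₗᵢ[ℂ] K)) : Prop where
  measurable : Measurable φ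
  map_one : ∀ᵐ x ∂α, φ (1, x) = 1
  map_mul : ∀ᵐ p : G × G × X ∂(μ.prod (μ.prod α)), ∀ v : K,
    φ (p.1 * p.2.1, p.2.2) v
      = (m p.1 p.2.1 : ℂ) • φ (p.1, p.2.1 • p.2.2) (φ (p.2.1, p.2.2) v)

/-- Two cocycles are cohomologous if `φ' (g, x) = b (g · x) φ (g, x) b (x)⁻¹` for almost all
`(g, x)`, for some Borel map `b : X → 𝒰(K)`. -/
def Cohomologous {G : Type*} [Group G] [MeasurableSpace G] (μ : Measure G)
    {X : Type*} [MeasurableSpace X] [MulAction G X] (α : Measure X)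
    {K : Type*} [NormedAddCommGroup K] [InnerProductSpace ℂ K]
    (φ φ' : G × X → (K ≃ₗᵢ[ℂ] K)) : Prop :=
  ∃ b : X → (K ≃ₗᵢ[ℂ] K), Measurable b ∧
    ∀ᵐ p : G × X ∂(μ.prod α), φ' p = b (p.1 • p.2) * φ p * (b p.2)⁻¹

/-- The system `S = (U, P)` acting in `L²(X, K, α)` is given by `P_E f = χ_E f` and, for almost all
`g`, by `(U_g f)(x) = r_g(g⁻¹ x)^{1/2} φ(g, g⁻¹ x) f(g⁻¹ x)`. -/
structure IsGivenByCocycle {G : Type*} [Group G] [MeasurableSpace G] (μ : Measure G)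
    {m : G → G → Circle} {X : Type*} [MeasurableSpace X] [MulAction G X] [MeasurableSMul₂ G X]
    (α : Measure X) (r : G → X → NNReal)
    {K : Type*} [NormedAddCommGroup K] [InnerProductSpace ℂ K] [CompleteSpace K]
    (φ : G × X → (K ≃ₗᵢ[ℂ] K)) (S : MSystemOfImprimitivity m X (Lp K 2 α)) : Prop where
  proj : ∀ (E : BorelSubset X) (f : Lp K 2 α), S.P E f =ᵐ[α] E.1.indicator f
  repr : ∀ᵐ g ∂μ, ∀ f : Lp K 2 α, ∀ᵐ x ∂α,
    S.U g f x = ((Real.sqrt (r g (g⁻¹ • x)) : ℝ) : ℂ) • φ (g, g⁻¹ • x) (f (g⁻¹ • x))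

/-! For every `g` the operator `V g : f ↦ (r_g^{1/2} φ(g, ·) f) ∘ g⁻¹` is unitary on `L²`, because
`r_g` is the density that compensates for the change of measure. The chain rule and the uniqueness
of densities give `r_{ab}(x) = r_a(b x) r_b(x)` for almost all `x`, so the cocycle identity yields
`V (ab) = m(a,b) V a V b`, but only for almost all `(a,b)`.

To repair this (`exists_mRepresentation_of_ae`), write any `g` as a product `ab` of two generic
elements and put `U g = m(a,b) V a V b`. Then `V (gh) = m(g,h) U g V h` for almost all `h`. As `V h`
can be cancelled, this relation pins down `U g`; evaluating it at a common good `h` gives exact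
multiplicativity and `U = V` almost everywhere. A similar cancellation (`mRepresentation_ext_ae`)
gives uniqueness. Each `V a` carries `P_E` to `P_{aE}`, so the products `U g` satisfy the
imprimitivity relation for every `g`.

Measurability is the delicate point, since `r_g` is chosen separately for each `g`. A Radon–Nikodym
derivative on `G × X` supplies a jointly measurable density whose sections agree with `r_g` for
almost all `g`; separability of `L²` reduces this to countably many test functions. Fubini then
makes the coefficients of `V` almost everywhere measurable, and averaging over the group makes `U`
measurable (`measurable_mRepresentation`).

For equivalence, multiplication by `(dα/dα')^{1/2} b` intertwines the two systems for almost all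
`g`, hence for all `g` by the same rigidity. -/

open Filter Topology

/-! ### Measurability of maps into the unitary group -/

section UnitaryBorel

variable {Ω H : Type*} [MeasurableSpace Ω] [NormedAddCommGroup H] [InnerProductSpace ℂ H]

theorem measurable_unitary_iff {u : Ω → H ≃ₗᵢ[ℂ] H} :
    Measurable u ↔ ∀ v w : H, Measurable fun x => inner ℂ v (u x w) := by
  rw [measurable_iff_comap_le]
  simp only [unitaryBorel, MeasurableSpace.comap_iSup, iSup_le_iff, MeasurableSpace.comap_comp,
    ← measurable_iff_comap_le, Function.comp_def]

/-- Weakly measurable functions into a separable Hilbert space are strongly measurable. -/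
theorem stronglyMeasurable_of_inner [TopologicalSpace.SeparableSpace H] {f : Ω → H}
    (hf : ∀ v : H, Measurable fun x => inner ℂ v (f x)) : StronglyMeasurable f := by
  borelize H
  have : SecondCountableTopology H := UniformSpace.secondCountable_of_separable H
  rcases subsingleton_or_nontrivial H with hs | hs
  · exact stronglyMeasurable_const' fun _ _ => Subsingleton.elim _ _
  -- The norm is a supremum of inner products against a dense sequence, so closed balls are
  -- countable intersections of weakly measurable conditions.
  have key : ∀ (c : H) (r : ℝ), MeasurableSet (f ⁻¹' Metric.closedBall c r) := by
    intro c r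
    have : f ⁻¹' Metric.closedBall c r = ⋂ n : ℕ,
        {x | ‖inner ℂ (TopologicalSpace.denseSeq H n) (f x) -
          inner ℂ (TopologicalSpace.denseSeq H n) c‖
            ≤ r * ‖TopologicalSpace.denseSeq H n‖} := by
      ext x
      simp only [Set.mem_preimage, Metric.mem_closedBall, dist_eq_norm, Set.mem_iInter,
        Set.mem_ofPred_eq, ← inner_sub_right]
      constructor
      · intro h n
        refine (norm_inner_le_norm _ _).trans ?_
        rw [mul_comm]
        gcongr
      · intro h
        have h' : ∀ d : H, ‖inner ℂ d (f x - c)‖ ≤ r * ‖d‖ := by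
          intro d
          refine (TopologicalSpace.denseRange_denseSeq H).induction_on d ?_ h
          exact isClosed_le (by fun_prop) (by fun_prop)
        rcases eq_or_ne (f x - c) 0 with h0 | h0
        · rw [h0]
          -- When `f x = c` the claim is `0 ≤ r`, which only a nonzero test vector can reveal.
          obtain ⟨d, hd⟩ := exists_ne (0 : H)
          have h1 := (norm_nonneg _).trans (h' d)
          rw [norm_zero]
          exact nonneg_of_mul_nonneg_left h1 (norm_pos_iff.2 hd)
        · have h1 := h' (f x - c)
          rw [inner_self_eq_norm_sq_to_K] at h1
          have h2 : 0 < ‖f x - c‖ := norm_pos_iff.2 h0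
          have h3 : ‖f x - c‖ * ‖f x - c‖ ≤ r * ‖f x - c‖ := by
            simpa [sq] using h1
          exact le_of_mul_le_mul_right h3 h2
    rw [this]
    exact MeasurableSet.iInter fun n =>
      measurableSet_le ((hf _).sub measurable_const).norm measurable_const
  refine (measurable_of_isOpen fun U hU => ?_).stronglyMeasurable
  have : f ⁻¹' U = ⋃ (n : ℕ) (q : ℚ)
      (_ : Metric.closedBall (TopologicalSpace.denseSeq H n) (q : ℝ) ⊆ U),
      f ⁻¹' Metric.closedBall (TopologicalSpace.denseSeq H n) (q : ℝ) := by
    ext x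
    simp only [Set.mem_preimage, Set.mem_iUnion, exists_prop]
    constructor
    · intro hx
      obtain ⟨ε, hε, hb⟩ := Metric.isOpen_iff.1 hU _ hx
      obtain ⟨q, hq0, hq⟩ := exists_rat_btwn (half_pos hε)
      obtain ⟨n, hn⟩ := (TopologicalSpace.denseRange_denseSeq H).exists_dist_lt (f x) hq0
      refine ⟨n, q, fun y hy => hb ?_, hn.le⟩
      rw [Metric.mem_closedBall] at hy
      rw [Metric.mem_ball]
      have := dist_triangle_right y (f x) (TopologicalSpace.denseSeq H n)
      linarith
    · rintro ⟨n, q, h, hx⟩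
      exact h hx
  rw [this]
  exact MeasurableSet.iUnion fun n => MeasurableSet.iUnion fun q => MeasurableSet.iUnion fun _ =>
    key _ _

/-- This is Carathéodory's criterion: `u x k` is measurable in `x` and continuous in `k`. -/
theorem stronglyMeasurable_unitary_apply [TopologicalSpace.SeparableSpace H]
    {u : Ω → H ≃ₗᵢ[ℂ] H} (hu : Measurable u) {f : Ω → H} (hf : StronglyMeasurable f) :
    StronglyMeasurable fun x => u x (f x) := by
  borelize H
  have : SecondCountableTopology H := UniformSpace.secondCountable_of_separable H
  have h := stronglyMeasurable_uncurry_of_continuous_of_stronglyMeasurable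
    (u := fun (k : H) (x : Ω) => u x k) (fun x => (u x).continuous)
    (fun k => stronglyMeasurable_of_inner fun v => measurable_unitary_iff.1 hu v k)
  exact h.comp_measurable (hf.measurable.prodMk measurable_id)

theorem measurable_unitary_inv {u : Ω → H ≃ₗᵢ[ℂ] H} (hu : Measurable u) :
    Measurable fun x => (u x)⁻¹ := by
  rw [measurable_unitary_iff] at hu ⊢
  intro v w
  have : (fun x => inner ℂ v ((u x)⁻¹ w)) = fun x => (starRingEnd ℂ) (inner ℂ w (u x v)) := by
    ext x
    rw [inner_conj_symm, ← LinearIsometryEquiv.inner_map_map (u x) v, LinearIsometryEquiv.inv_def,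
      LinearIsometryEquiv.apply_symm_apply]
  rw [this]
  exact Complex.continuous_conj.measurable.comp (hu w v)

/-- Coefficients along a dense sequence are countably many, so one null set handles them all.
Resetting `u` to `1` there makes them measurable, and the other coefficients are pointwise limits.
-/
theorem aemeasurable_unitary_of_inner [TopologicalSpace.SeparableSpace H] {μ : Measure Ω}
    {u : Ω → H ≃ₗᵢ[ℂ] H} (hu : ∀ v w : H, AEMeasurable (fun x => inner ℂ v (u x w)) μ) :
    AEMeasurable u μ := by
  classical
  let d := TopologicalSpace.denseSeq H
  have hd : DenseRange d := TopologicalSpace.denseRange_denseSeq H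
  have h : ∀ᵐ x ∂μ, ∀ p : ℕ × ℕ,
      inner ℂ (d p.1) (u x (d p.2)) = (hu (d p.1) (d p.2)).mk _ x :=
    ae_all_iff.2 fun p => (hu (d p.1) (d p.2)).ae_eq_mk
  obtain ⟨s, hsN, hs, hs0⟩ := exists_measurable_superset_of_null (ae_iff.1 h)
  refine ⟨fun x => if x ∈ s then 1 else u x, measurable_unitary_iff.2 ?_, ?_⟩
  · have key : ∀ p : ℕ × ℕ, Measurable fun x =>
        inner ℂ (d p.1) ((if x ∈ s then (1 : H ≃ₗᵢ[ℂ] H) else u x) (d p.2)) := by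
      intro p
      have : (fun x => inner ℂ (d p.1) ((if x ∈ s then (1 : H ≃ₗᵢ[ℂ] H) else u x) (d p.2)))
          = fun x => if x ∈ s then inner ℂ (d p.1) (d p.2) else (hu (d p.1) (d p.2)).mk _ x := by
        ext x
        split_ifs with hx
        · rfl
        · by_contra hne
          exact hx (hsN fun h' => hne (h' p))
      rw [this]
      exact Measurable.ite hs measurable_const (hu _ _).measurable_mk
    intro v w
    obtain ⟨a, ha⟩ := mem_closure_iff_seq_limit.1 (hd v)
    obtain ⟨b, hb⟩ := mem_closure_iff_seq_limit.1 (hd w)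
    choose i hi using ha.1
    choose j hj using hb.1
    refine measurable_of_tendsto_metrizable (fun n => key (i n, j n)) ?_
    rw [tendsto_pi_nhds]
    intro x
    simp only [hi, hj]
    exact ha.2.inner (((LinearIsometryEquiv.continuous _).tendsto _).comp hb.2)
  · have : ∀ᵐ x ∂μ, x ∉ s := measure_eq_zero_iff_ae_notMem.1 hs0
    filter_upwards [this] with x hx
    simp [hx]

end UnitaryBorel

/-! ### From almost everywhere to everywhere multiplicative maps -/

section MRepresentation

variable {G : Type*} [Group G] [TopologicalSpace G] [IsTopologicalGroup G]
  [SecondCountableTopology G] [MeasurableSpace G] [BorelSpace G]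
  (μ : Measure G) [μ.IsMulLeftInvariant] [SigmaFinite μ] [NeZero μ]
  {m : G → G → Circle}
  {H : Type*} [NormedAddCommGroup H] [InnerProductSpace ℂ H]

/-- Multiplication by a complex number of modulus `1` as a unitary operator. -/
noncomputable def circleSMul (c : Circle) : H ≃ₗᵢ[ℂ] H where
  toLinearEquiv := LinearEquiv.smulOfNeZero ℂ H (c : ℂ) c.coe_ne_zero
  norm_map' v := by
    change ‖(c : ℂ) • v‖ = ‖v‖
    rw [norm_smul, Circle.norm_coe, one_mul]

@[simp]
theorem circleSMul_apply (c : Circle) (v : H) : circleSMul c v = (c : ℂ) • v := rfl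

/-- An almost everywhere multiplicative map, up to a multiplier, into a unitary group agrees
almost everywhere with an everywhere multiplicative one, whose values are products of values of the
original map. -/
theorem exists_mRepresentation_of_ae (hm : IsMultiplier m) {V : G → H ≃ₗᵢ[ℂ] H}
    (hV : ∀ᵐ a ∂μ, ∀ᵐ b ∂μ, ∀ v, V (a * b) v = (m a b : ℂ) • V a (V b v)) :
    ∃ U : G → H ≃ₗᵢ[ℂ] H, (∀ a b v, U (a * b) v = (m a b : ℂ) • U a (U b v)) ∧
      (∀ᵐ a ∂μ, U a = V a) ∧
      ∀ g, ∃ a b, a * b = g ∧ ∀ v, U g v = (m a b : ℂ) • V a (V b v) := by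
  have massoc : ∀ a b c, (m (a * b) c : ℂ) * m a b = m a (b * c) * m b c := fun a b c => by
    exact_mod_cast congrArg (fun z : Circle => (z : ℂ)) (hm.assoc a b c)
  have hsplit : ∀ g, ∃ a b, a * b = g ∧ (∀ᵐ h ∂μ, ∀ v, V (a * h) v = (m a h : ℂ) • V a (V h v)) ∧
      ∀ᵐ h ∂μ, ∀ v, V (b * h) v = (m b h : ℂ) • V b (V h v) := by
    intro g
    -- The map `b ↦ g / b` pulls null sets back to null sets, so almost every `b` is good together
    -- with `g / b`.
    obtain ⟨b, h1, h2⟩ := (((quasiMeasurePreserving_div_left μ g).ae hV).and hV).exists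
    exact ⟨g / b, b, by simp, h1, h2⟩
  choose a b hab ha hb using hsplit
  have hU : ∀ g, ∀ᵐ h ∂μ, ∀ v, V (g * h) v
      = (m g h : ℂ) • (m (a g) (b g) : ℂ) • V (a g) (V (b g) (V h v)) := by
    intro g
    filter_upwards [(eventually_mul_left_iff μ (b g)).2 (ha g), hb g] with h h1 h2 v
    rw [← mul_assoc, hab] at h1
    rw [h1, h2, map_smul, smul_smul, smul_smul, ← massoc, hab]
  refine ⟨fun g => circleSMul (m (a g) (b g)) * (V (a g) * V (b g)), fun g g' v => ?_, ?_,
    fun g => ⟨a g, b g, hab g, fun v => rfl⟩⟩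
  -- Expand `V (g g' h)` directly and through `g' h`; cancelling `V h` leaves an identity of
  -- scalars, the multiplier equation at `(g, g', h)`.
  · obtain ⟨h, h1, h2, h3⟩ := ((hU (g * g')).and ((hU g').and
      ((eventually_mul_left_iff μ g').2 (hU g)))).exists
    obtain ⟨w, rfl⟩ := (V h).surjective v
    have h4 := h1 w
    rw [mul_assoc, h3, h2] at h4
    simp only [LinearIsometryEquiv.coe_mul, Function.comp_apply, circleSMul_apply, map_smul,
      smul_smul] at h4 ⊢
    have h5 : (m (g * g') h : ℂ) ≠ 0 := Circle.coe_ne_zero _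
    apply smul_right_injective H h5
    simp only [smul_smul]
    rw [← h4]
    congr 1
    linear_combination (-(m (a g) (b g) : ℂ) * m (a g') (b g')) * massoc g g' h
  · filter_upwards [hV] with g hg
    obtain ⟨h, h1, h2⟩ := (hg.and (hU g)).exists
    ext v
    obtain ⟨w, rfl⟩ := (V h).surjective v
    have h3 := h1 w
    rw [h2] at h3
    exact smul_right_injective H (Circle.coe_ne_zero _) h3

omit [SecondCountableTopology G] [SigmaFinite μ] in
/-- Two multiplicative maps, up to the same multiplier, that agree almost everywhere are equal. -/
theorem mRepresentation_ext_ae {U U' : G → H ≃ₗᵢ[ℂ] H}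
    (hU : ∀ a b v, U (a * b) v = (m a b : ℂ) • U a (U b v))
    (hU' : ∀ a b v, U' (a * b) v = (m a b : ℂ) • U' a (U' b v))
    (h : ∀ᵐ g ∂μ, U g = U' g) : U = U' := by
  ext g v
  obtain ⟨b, h1, h2⟩ := (h.and ((eventually_mul_left_iff μ g).2 h)).exists
  obtain ⟨w, rfl⟩ := (U b).surjective v
  have h3 := hU g b w
  rw [h2, hU', ← h1] at h3
  exact (smul_right_injective H (Circle.coe_ne_zero _) h3).symm

/-- An almost everywhere measurable multiplicative map, up to a multiplier, is measurable. -/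
theorem measurable_mRepresentation [TopologicalSpace.SeparableSpace H] (hm : IsMultiplier m)
    {U : G → H ≃ₗᵢ[ℂ] H} (hU : ∀ a b v, U (a * b) v = (m a b : ℂ) • U a (U b v))
    (hU' : AEMeasurable U μ) : Measurable U := by
  obtain ⟨V, hV, hUV⟩ := hU'
  have hνμ := toFinite_absolutelyContinuous μ
  -- A probability measure dominated by `μ`, so that averaging a constant returns that constant.
  set ν := μ.toFinite
  rw [measurable_unitary_iff]
  intro v w
  have hF : StronglyMeasurable fun p : G × G =>
      (m p.1 p.2 : ℂ)⁻¹ * inner ℂ ((V (p.1 * p.2))⁻¹ v) ((V p.2)⁻¹ w) := by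
    refine hm.measurable.stronglyMeasurable.inv₀.mul (StronglyMeasurable.inner ?_ ?_)
    · exact stronglyMeasurable_unitary_apply
        (measurable_unitary_inv (hV.comp measurable_mul)) stronglyMeasurable_const
    · exact stronglyMeasurable_unitary_apply
        (measurable_unitary_inv (hV.comp measurable_snd)) stronglyMeasurable_const
  -- From `U g = m(g,h)⁻¹ U (gh) (U h)⁻¹`, the integrand is almost everywhere the constant `⟪v, U g
  -- w⟫`. With `V` in place of `U` it is jointly measurable in `(g, h)`.
  have hint : ∀ g, inner ℂ v (U g w) = ∫ h,
      (m g h : ℂ)⁻¹ * inner ℂ ((V (g * h))⁻¹ v) ((V h)⁻¹ w) ∂ν := by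
    intro g
    have : ∀ᵐ h ∂ν, (m g h : ℂ)⁻¹ * inner ℂ ((V (g * h))⁻¹ v) ((V h)⁻¹ w)
        = inner ℂ v (U g w) := by
      filter_upwards [hνμ.ae_le hUV, hνμ.ae_le ((eventually_mul_left_iff μ g).2 hUV)]
        with h h1 h2
      obtain ⟨k, rfl⟩ := (U h).surjective w
      rw [← h1, ← h2, ← LinearIsometryEquiv.inner_map_map (U (g * h))]
      simp only [LinearIsometryEquiv.inv_def, LinearIsometryEquiv.apply_symm_apply,
        LinearIsometryEquiv.symm_apply_apply]
      rw [hU, inner_smul_right, inv_mul_cancel_left₀ (Circle.coe_ne_zero _)]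
    rw [integral_congr_ae this]
    simp
  simp_rw [hint]
  exact hF.integral_prod_right.measurable

end MRepresentation

/-! ### Weighted composition operators between `L²` spaces -/

section WeightedComposition

variable {X X' X'' : Type*} [MeasurableSpace X] [MeasurableSpace X'] [MeasurableSpace X'']
  {α : Measure X} {α' : Measure X'} {α'' : Measure X''}

theorem map_withDensity_measurableEquiv (T : X ≃ᵐ X') (α : Measure X) (w : X → ENNReal) :
    (α.withDensity w).map T = (α.map T).withDensity fun x => w (T.symm x) := by
  ext s hs
  rw [T.map_apply, withDensity_apply _ (T.measurable hs), withDensity_apply _ hs,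
    T.restrict_map, lintegral_map_equiv]
  simp

/-- `w` is a density of `α` with respect to the pullback of `α'` under `T`, and these two measures
have the same null sets. -/
structure IsTransferWeight (T : X ≃ᵐ X') (α : Measure X) (α' : Measure X') (w : X → NNReal) :
    Prop where
  measurable : Measurable w
  eq_withDensity : α = (α'.map T.symm).withDensity fun x => (w x : ENNReal)
  ac : α'.map T.symm ≪ α

namespace IsTransferWeight

variable {T : X ≃ᵐ X'} {w w' : X → NNReal}

theorem quasiMeasurePreserving_symm (h : IsTransferWeight T α α' w) :
    Measure.QuasiMeasurePreserving T.symm α' α := ⟨T.symm.measurable, h.ac⟩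

theorem absolutelyContinuous (h : IsTransferWeight T α α' w) : α ≪ α'.map T.symm := by
  rw [h.eq_withDensity]
  exact withDensity_absolutelyContinuous _ _

theorem quasiMeasurePreserving (h : IsTransferWeight T α α' w) :
    Measure.QuasiMeasurePreserving T α α' := by
  refine ⟨T.measurable, ?_⟩
  have := h.absolutelyContinuous.map T.measurable
  rwa [T.map_map_symm] at this

theorem lintegral_eq (h : IsTransferWeight T α α' w) {f : X → ENNReal} (hf : Measurable f) :
    ∫⁻ x, f x ∂α = ∫⁻ x, w (T.symm x) * f (T.symm x) ∂α' := by
  conv_lhs => rw [h.eq_withDensity]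
  rw [lintegral_withDensity_eq_lintegral_mul _ h.measurable.coe_nnreal_ennreal hf,
    lintegral_map_equiv]
  rfl

theorem ae_ne_zero (h : IsTransferWeight T α α' w) : ∀ᵐ x ∂α, w x ≠ 0 := by
  have h1 : ∀ᵐ x ∂(α'.map T.symm).withDensity (fun x => (w x : ENNReal)), (w x : ENNReal) ≠ 0 :=
    (ae_withDensity_iff h.measurable.coe_nnreal_ennreal).2 (ae_of_all _ fun _ h => h)
  rw [← h.eq_withDensity] at h1
  simpa using h1

theorem symm (h : IsTransferWeight T α α' w) :
    IsTransferWeight T.symm α' α fun x => (w (T.symm x))⁻¹ := by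
  refine ⟨(h.measurable.comp T.symm.measurable).inv, ?_, h.quasiMeasurePreserving.2⟩
  have h0 : ∀ᵐ x ∂α'.map T.symm, (w x : ENNReal) ≠ 0 := by
    filter_upwards [h.ac.ae_le h.ae_ne_zero] with x hx
    simpa using hx
  have h1 : α.withDensity (fun x => (w x : ENNReal))⁻¹ = α'.map T.symm := by
    conv_lhs => rw [h.eq_withDensity]
    exact withDensity_inv_same h.measurable.coe_nnreal_ennreal h0 (by simp)
  have h2 := congrArg (Measure.map T) h1
  rw [T.map_map_symm, map_withDensity_measurableEquiv] at h2
  rw [← h2]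
  refine withDensity_congr_ae ?_
  rw [Filter.EventuallyEq, T.measurableEmbedding.ae_map_iff]
  filter_upwards [h.ae_ne_zero] with x hx
  simp [ENNReal.coe_inv hx]

/-- The chain rule for Radon–Nikodym derivatives, valid for every pair of transformations. -/
theorem trans {T' : X' ≃ᵐ X''} {v : X' → NNReal} (h : IsTransferWeight T α α' w)
    (h' : IsTransferWeight T' α' α'' v) :
    IsTransferWeight (T.trans T') α α'' fun x => v (T x) * w x := by
  have hmap : α''.map (T.trans T').symm = (α''.map T'.symm).map T.symm :=
    (Measure.map_map T.symm.measurable T'.symm.measurable).symm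
  refine ⟨(h'.measurable.comp T.measurable).mul h.measurable, ?_, ?_⟩
  · have h1 := congrArg (Measure.map T.symm) h'.eq_withDensity
    rw [map_withDensity_measurableEquiv] at h1
    conv_lhs => rw [h.eq_withDensity, h1]
    have h2 := withDensity_mul ((α''.map T'.symm).map T.symm)
      (h'.measurable.comp T.measurable).coe_nnreal_ennreal h.measurable.coe_nnreal_ennreal
    rw [hmap]
    simp only [ENNReal.coe_mul]
    exact h2.symm
  · rw [hmap]
    exact (h'.ac.map T.symm.measurable).trans h.ac

/-- Uniqueness of densities turns the chain rule into almost everywhere identities between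
independently chosen versions. -/
theorem ae_eq [SigmaFinite α'] (h : IsTransferWeight T α α' w) (h' : IsTransferWeight T α α' w') :
    w =ᵐ[α] w' := by
  have : SigmaFinite (α'.map T.symm) := T.symm.sigmaFinite_map
  have h1 := h.eq_withDensity.symm.trans h'.eq_withDensity
  rw [withDensity_eq_iff_of_sigmaFinite h.measurable.coe_nnreal_ennreal.aemeasurable
    h'.measurable.coe_nnreal_ennreal.aemeasurable] at h1
  filter_upwards [h.absolutelyContinuous.ae_le h1] with x hx
  simpa using hx

end IsTransferWeight

variable {K : Type*} [NormedAddCommGroup K] [InnerProductSpace ℂ K]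

/-- `V` is the operator `f ↦ (w^{1/2} u f) ∘ T⁻¹`. -/
def IsWeightedComp (T : X ≃ᵐ X') (w : X → NNReal) (u : X → K ≃ₗᵢ[ℂ] K)
    (V : Lp K 2 α → Lp K 2 α') : Prop :=
  ∀ f : Lp K 2 α, ∀ᵐ x ∂α', V f x =
    ((Real.sqrt (w (T.symm x)) : ℝ) : ℂ) • u (T.symm x) (f (T.symm x))

omit [InnerProductSpace ℂ K] in
theorem eLpNorm_two_eq_lintegral (f : X → K) :
    eLpNorm f 2 α = (∫⁻ x, ‖f x‖ₑ ^ 2 ∂α) ^ (1 / 2 : ℝ) := by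
  rw [eLpNorm_eq_lintegral_rpow_enorm_toReal (by simp) (by simp)]
  simp

theorem enorm_sqrt_smul_sq (c : NNReal) (k : K) :
    ‖((Real.sqrt c : ℝ) : ℂ) • k‖ₑ ^ 2 = c * ‖k‖ₑ ^ 2 := by
  rw [enorm_smul, mul_pow]
  congr 1
  rw [← ofReal_norm, Complex.norm_real, Real.norm_of_nonneg (Real.sqrt_nonneg _),
    ← ENNReal.ofReal_pow (Real.sqrt_nonneg _), Real.sq_sqrt c.coe_nonneg]
  simp

theorem eLpNorm_weightedComp {T : X ≃ᵐ X'} {w : X → NNReal} (h : IsTransferWeight T α α' w)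
    (u : X → K ≃ₗᵢ[ℂ] K) (f : Lp K 2 α) :
    eLpNorm (fun x => ((Real.sqrt (w (T.symm x)) : ℝ) : ℂ) • u (T.symm x) (f (T.symm x))) 2 α'
      = eLpNorm f 2 α := by
  rw [eLpNorm_two_eq_lintegral, eLpNorm_two_eq_lintegral,
    h.lintegral_eq ((Lp.stronglyMeasurable f).enorm.pow_const 2)]
  congr 1
  refine lintegral_congr fun x => ?_
  rw [enorm_sqrt_smul_sq, LinearIsometryEquiv.enorm_map]

theorem stronglyMeasurable_weightedComp [TopologicalSpace.SeparableSpace K]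
    {T : X ≃ᵐ X'} {w : X → NNReal} (hw : Measurable w)
    {u : X → K ≃ₗᵢ[ℂ] K} (hu : Measurable u) (f : Lp K 2 α) :
    StronglyMeasurable
      fun x => ((Real.sqrt (w (T.symm x)) : ℝ) : ℂ) • u (T.symm x) (f (T.symm x)) := by
  refine StronglyMeasurable.smul ?_ ?_
  · exact (Complex.measurable_ofReal.comp
      (hw.comp T.symm.measurable).coe_nnreal_real.sqrt).stronglyMeasurable
  · exact (stronglyMeasurable_unitary_apply hu (Lp.stronglyMeasurable f)).comp_measurable
      T.symm.measurable

theorem memLp_weightedComp [TopologicalSpace.SeparableSpace K]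
    {T : X ≃ᵐ X'} {w : X → NNReal} (h : IsTransferWeight T α α' w)
    {u : X → K ≃ₗᵢ[ℂ] K} (hu : Measurable u) (f : Lp K 2 α) :
    MemLp (fun x => ((Real.sqrt (w (T.symm x)) : ℝ) : ℂ) • u (T.symm x) (f (T.symm x))) 2 α' :=
  ⟨(stronglyMeasurable_weightedComp h.measurable hu f).aestronglyMeasurable, by
    rw [eLpNorm_weightedComp h]
    exact Lp.eLpNorm_lt_top f⟩

/-- The operator `f ↦ (w^{1/2} u f) ∘ T⁻¹` as a linear isometry. -/
noncomputable def weightedCompIsometry [TopologicalSpace.SeparableSpace K]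
    {T : X ≃ᵐ X'} {w : X → NNReal} (h : IsTransferWeight T α α' w)
    {u : X → K ≃ₗᵢ[ℂ] K} (hu : Measurable u) : Lp K 2 α →ₗᵢ[ℂ] Lp K 2 α' where
  toFun f := (memLp_weightedComp h hu f).toLp _
  map_add' f g := by
    apply Lp.ext
    filter_upwards [(memLp_weightedComp h hu (f + g)).coeFn_toLp,
      Lp.coeFn_add ((memLp_weightedComp h hu f).toLp _) ((memLp_weightedComp h hu g).toLp _),
      (memLp_weightedComp h hu f).coeFn_toLp, (memLp_weightedComp h hu g).coeFn_toLp,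
      h.quasiMeasurePreserving_symm.ae (Lp.coeFn_add f g)] with x h1 h2 h3 h4 h5
    rw [h1, h2, Pi.add_apply, h3, h4, h5, Pi.add_apply, map_add, smul_add]
  map_smul' c f := by
    apply Lp.ext
    filter_upwards [(memLp_weightedComp h hu (c • f)).coeFn_toLp,
      Lp.coeFn_smul c ((memLp_weightedComp h hu f).toLp _),
      (memLp_weightedComp h hu f).coeFn_toLp,
      h.quasiMeasurePreserving_symm.ae (Lp.coeFn_smul c f)] with x h1 h2 h3 h5
    rw [h1, RingHom.id_apply, h2, Pi.smul_apply, h3, h5, Pi.smul_apply, map_smul, smul_comm]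
  norm_map' f := by
    change ‖(memLp_weightedComp h hu f).toLp _‖ = _
    rw [Lp.norm_toLp, eLpNorm_weightedComp h, Lp.norm_def]

theorem isWeightedComp_weightedCompIsometry [TopologicalSpace.SeparableSpace K]
    {T : X ≃ᵐ X'} {w : X → NNReal} (h : IsTransferWeight T α α' w)
    {u : X → K ≃ₗᵢ[ℂ] K} (hu : Measurable u) :
    IsWeightedComp T w u (weightedCompIsometry h hu) :=
  fun f => (memLp_weightedComp h hu f).coeFn_toLp

namespace IsWeightedComp

variable {T : X ≃ᵐ X'} {w w' : X → NNReal} {u u' : X → K ≃ₗᵢ[ℂ] K} {V V' : Lp K 2 α → Lp K 2 α'}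

theorem trans {T' : X' ≃ᵐ X''} {v : X' → NNReal} {t : X' → K ≃ₗᵢ[ℂ] K}
    {V' : Lp K 2 α' → Lp K 2 α''} (h : IsWeightedComp T w u V) (h' : IsWeightedComp T' v t V')
    (hT : Measure.QuasiMeasurePreserving T'.symm α'' α') :
    IsWeightedComp (T.trans T') (fun x => v (T x) * w x) (fun x => t (T x) * u x)
      fun f => V' (V f) := by
  intro f
  filter_upwards [h' (V f), hT.ae (h f)] with x h1 h2
  have h3 : T (T.symm (T'.symm x)) = T'.symm x := T.apply_symm_apply _
  rw [h1, h2, map_smul, smul_smul, ← Complex.ofReal_mul, ← Real.sqrt_mul (NNReal.coe_nonneg _)]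
  change _ =
    ((Real.sqrt ((v (T (T.symm (T'.symm x))) * w (T.symm (T'.symm x)) : NNReal) : ℝ) : ℝ) : ℂ)
    • t (T (T.symm (T'.symm x))) (u (T.symm (T'.symm x)) (f (T.symm (T'.symm x))))
  rw [h3, NNReal.coe_mul]

theorem congr (h : IsWeightedComp T w u V) (hT : Measure.QuasiMeasurePreserving T.symm α' α)
    (hw : w =ᵐ[α] w') (hu : u =ᵐ[α] u') : IsWeightedComp T w' u' V := by
  intro f
  filter_upwards [h f, hT.ae hw, hT.ae hu] with x h1 h2 h3
  rw [h1, h2, h3]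

theorem unique (h : IsWeightedComp T w u V) (h' : IsWeightedComp T w u V') : V = V' := by
  ext1 f
  apply Lp.ext
  filter_upwards [h f, h' f] with x h1 h2
  rw [h1, h2]

theorem circleSMul (h : IsWeightedComp T w u V) (c : Circle) :
    IsWeightedComp T w (fun x => _root_.circleSMul c * u x) fun f => (c : ℂ) • V f := by
  intro f
  filter_upwards [h f, Lp.coeFn_smul (c : ℂ) (V f)] with x h1 h2
  rw [h2, Pi.smul_apply, h1, smul_comm]
  rfl

theorem indicator (h : IsWeightedComp T w u V)
    (hT : Measure.QuasiMeasurePreserving T.symm α' α) {f f' : Lp K 2 α} {E : Set X}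
    (hf : f' =ᵐ[α] E.indicator f) : V f' =ᵐ[α'] (T '' E).indicator (V f) := by
  filter_upwards [h f, h f', hT.ae hf] with x h1 h2 h3
  rw [h2, h3]
  have : x ∈ T '' E ↔ T.symm x ∈ E := by
    rw [T.image_eq_preimage_symm]
    rfl
  by_cases hx : T.symm x ∈ E
  · rw [Set.indicator_of_mem hx, Set.indicator_of_mem (this.2 hx), h1]
  · rw [Set.indicator_of_notMem hx, Set.indicator_of_notMem (mt this.1 hx), map_zero, smul_zero]

end IsWeightedComp

theorem exists_isWeightedComp [TopologicalSpace.SeparableSpace K]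
    {T : X ≃ᵐ X'} {w : X → NNReal} (h : IsTransferWeight T α α' w)
    {u : X → K ≃ₗᵢ[ℂ] K} (hu : Measurable u) :
    ∃ V : Lp K 2 α ≃ₗᵢ[ℂ] Lp K 2 α', IsWeightedComp T w u V := by
  have hu' : Measurable fun x => (u (T.symm x))⁻¹ :=
    measurable_unitary_inv (hu.comp T.symm.measurable)
  -- The preimage comes from the same construction for `T⁻¹`, with inverse weight and inverse
  -- unitaries.
  refine ⟨LinearIsometryEquiv.ofSurjective (weightedCompIsometry h hu) fun f =>
    ⟨weightedCompIsometry h.symm hu' f, ?_⟩, isWeightedComp_weightedCompIsometry h hu⟩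
  apply Lp.ext
  filter_upwards [isWeightedComp_weightedCompIsometry h hu (weightedCompIsometry h.symm hu' f),
    h.quasiMeasurePreserving_symm.ae (isWeightedComp_weightedCompIsometry h.symm hu' f),
    h.quasiMeasurePreserving_symm.ae h.ae_ne_zero] with x h1 h2 h3
  rw [h1, h2, map_smul, smul_smul, ← Complex.ofReal_mul, ← Real.sqrt_mul (NNReal.coe_nonneg _)]
  simp [h3, LinearIsometryEquiv.inv_def]

end WeightedComposition

/-! ### The projection valued measure of indicator functions -/

section Projection

variable {X : Type*} [MeasurableSpace X] {α : Measure X}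
  {K : Type*} [NormedAddCommGroup K] [InnerProductSpace ℂ K]

/-- Multiplication by the indicator function of a measurable set on `L²`. -/
noncomputable def indicatorProj (α : Measure X) (K : Type*) [NormedAddCommGroup K]
    [InnerProductSpace ℂ K] (E : BorelSubset X) : Lp K 2 α →L[ℂ] Lp K 2 α :=
  LinearMap.mkContinuous
    { toFun := fun f => ((Lp.memLp f).indicator E.2).toLp _
      map_add' := fun f g => by
        apply Lp.ext
        filter_upwards [((Lp.memLp (f + g)).indicator E.2).coeFn_toLp,
          Lp.coeFn_add (((Lp.memLp f).indicator E.2).toLp _) (((Lp.memLp g).indicator E.2).toLp _),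
          ((Lp.memLp f).indicator E.2).coeFn_toLp, ((Lp.memLp g).indicator E.2).coeFn_toLp,
          Lp.coeFn_add f g] with x h1 h2 h3 h4 h5
        rw [h1, h2, Pi.add_apply, h3, h4]
        by_cases hx : x ∈ E.1
        · simp only [Set.indicator_of_mem hx, h5, Pi.add_apply]
        · simp only [Set.indicator_of_notMem hx, add_zero]
      map_smul' := fun c f => by
        apply Lp.ext
        filter_upwards [((Lp.memLp (c • f)).indicator E.2).coeFn_toLp,
          Lp.coeFn_smul c (((Lp.memLp f).indicator E.2).toLp _),
          ((Lp.memLp f).indicator E.2).coeFn_toLp, Lp.coeFn_smul c f] with x h1 h2 h3 h5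
        rw [h1, RingHom.id_apply, h2, Pi.smul_apply, h3]
        by_cases hx : x ∈ E.1
        · simp only [Set.indicator_of_mem hx, h5, Pi.smul_apply]
        · simp only [Set.indicator_of_notMem hx, smul_zero] } 1 fun f => by
    change ‖((Lp.memLp f).indicator E.2).toLp _‖ ≤ _
    rw [Lp.norm_toLp, one_mul, Lp.norm_def]
    exact ENNReal.toReal_mono (Lp.eLpNorm_ne_top f) (eLpNorm_indicator_le _)

theorem indicatorProj_apply (E : BorelSubset X) (f : Lp K 2 α) :
    indicatorProj α K E f =ᵐ[α] E.1.indicator f :=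
  ((Lp.memLp f).indicator E.2).coeFn_toLp

theorem norm_indicatorProj_sq (E : BorelSubset X) (f : Lp K 2 α) :
    ‖indicatorProj α K E f‖ ^ 2 = ∫ x in E.1, ‖f x‖ ^ 2 ∂α := by
  have h : (inner ℂ (indicatorProj α K E f) (indicatorProj α K E f) : ℂ)
      = ((∫ x in E.1, ‖f x‖ ^ 2 ∂α : ℝ) : ℂ) := by
    rw [L2.inner_def, ← integral_complex_ofReal, ← integral_indicator E.2]
    refine integral_congr_ae ?_
    filter_upwards [indicatorProj_apply E f] with x hx
    rw [hx]
    by_cases hE : x ∈ E.1 <;> simp [hE, inner_self_eq_norm_sq_to_K]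
  rw [inner_self_eq_norm_sq_to_K] at h
  apply Complex.ofReal_injective
  rw [← h]
  simp

theorem indicatorProj_comp (E F : BorelSubset X) (f : Lp K 2 α) :
    indicatorProj α K E (indicatorProj α K F f)
      = indicatorProj α K ⟨E.1 ∩ F.1, E.2.inter F.2⟩ f := by
  apply Lp.ext
  filter_upwards [indicatorProj_apply E (indicatorProj α K F f), indicatorProj_apply F f,
    indicatorProj_apply ⟨E.1 ∩ F.1, E.2.inter F.2⟩ f] with x h1 h2 h3
  rw [h1, h3]
  by_cases hx : x ∈ E.1 <;> by_cases hx' : x ∈ F.1 <;> simp [hx, hx', h2]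

theorem indicatorProj_inner (E : BorelSubset X) (f g : Lp K 2 α) :
    inner ℂ (indicatorProj α K E f) g = inner ℂ f (indicatorProj α K E g) := by
  rw [L2.inner_def, L2.inner_def]
  refine integral_congr_ae ?_
  filter_upwards [indicatorProj_apply E f, indicatorProj_apply E g] with x h1 h2
  rw [h1, h2]
  by_cases hx : x ∈ E.1 <;> simp [hx]

/-- The error of a partial sum is again such a projection, so its squared norm is the integral of
`‖f‖²` over the remaining set. Strong countable additivity thereby reduces to that of the integral.
-/
theorem indicatorProj_sub_sum {E : ℕ → BorelSubset X}
    (hE : Pairwise fun i j => Disjoint (E i).1 (E j).1) (s : Finset ℕ) (f : Lp K 2 α) :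
    (indicatorProj α K ⟨⋃ n, (E n).1, MeasurableSet.iUnion fun n => (E n).2⟩ f
      - ∑ n ∈ s, indicatorProj α K (E n) f)
      = indicatorProj α K ⟨(⋃ n, (E n).1) \ ⋃ n ∈ s, (E n).1,
          (MeasurableSet.iUnion fun n => (E n).2).diff
            (s.measurableSet_biUnion fun n _ => (E n).2)⟩ f := by
  induction s using Finset.induction_on with
  | empty => simp
  | insert a s ha ih =>
    rw [Finset.sum_insert ha, add_comm, ← sub_sub, ih]
    apply Lp.ext
    filter_upwards [indicatorProj_apply (K := K) (α := α) ⟨(⋃ n, (E n).1) \ ⋃ n ∈ s, (E n).1,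
          (MeasurableSet.iUnion fun n => (E n).2).diff
            (s.measurableSet_biUnion fun n _ => (E n).2)⟩ f,
      indicatorProj_apply ⟨(⋃ n, (E n).1) \ ⋃ n ∈ insert a s, (E n).1,
          (MeasurableSet.iUnion fun n => (E n).2).diff
            ((insert a s).measurableSet_biUnion fun n _ => (E n).2)⟩ f,
      indicatorProj_apply (E a) f, Lp.coeFn_sub (indicatorProj α K
        ⟨(⋃ n, (E n).1) \ ⋃ n ∈ s, (E n).1, (MeasurableSet.iUnion fun n => (E n).2).diff
            (s.measurableSet_biUnion fun n _ => (E n).2)⟩ f) (indicatorProj α K (E a) f)]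
      with x h1 h2 h3 h4
    rw [h4, Pi.sub_apply, h1, h2, h3]
    by_cases hx : x ∈ (E a).1
    · have h5 : x ∉ ⋃ n ∈ s, (E n).1 := by
        simp only [Set.mem_iUnion, not_exists]
        intro n hn hxn
        exact Set.disjoint_left.1 (hE (by rintro rfl; exact ha hn : n ≠ a)) hxn hx
      have h6 : x ∈ ⋃ n, (E n).1 := Set.mem_iUnion.2 ⟨a, hx⟩
      have h8 : x ∈ (⋃ n, (E n).1) \ ⋃ n ∈ s, (E n).1 := ⟨h6, h5⟩
      have h7 : x ∉ (⋃ n, (E n).1) \ ((E a).1 ∪ ⋃ n ∈ s, (E n).1) := fun h => h.2 (Or.inl hx)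
      simp only [Finset.set_biUnion_insert]
      rw [Set.indicator_of_mem h8, Set.indicator_of_mem hx,
        Set.indicator_of_notMem h7, sub_self]
    · rw [Set.indicator_of_notMem hx, sub_zero]
      simp only [Finset.set_biUnion_insert]
      have h7 : x ∈ (⋃ n, (E n).1) \ ((E a).1 ∪ ⋃ n ∈ s, (E n).1) ↔
          x ∈ (⋃ n, (E n).1) \ ⋃ n ∈ s, (E n).1 := by
        simp [hx]
      by_cases h8 : x ∈ (⋃ n, (E n).1) \ ⋃ n ∈ s, (E n).1
      · rw [Set.indicator_of_mem h8, Set.indicator_of_mem (h7.2 h8)]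
      · rw [Set.indicator_of_notMem h8, Set.indicator_of_notMem (mt h7.1 h8)]

theorem isProjectionValuedMeasure_indicatorProj [CompleteSpace K] :
    IsProjectionValuedMeasure (indicatorProj α K) where
  isStarProjection E := by
    refine ⟨?_, ?_⟩
    · ext1 f
      simp [indicatorProj_comp]
    · rw [ContinuousLinearMap.isSelfAdjoint_iff_isSymmetric]
      exact fun f g => indicatorProj_inner E f g
  empty := by
    ext1 f
    apply Lp.ext
    filter_upwards [indicatorProj_apply ⟨∅, MeasurableSet.empty⟩ f, Lp.coeFn_zero K 2 α]
      with x h1 h2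
    rw [h1, Set.indicator_empty]
    exact h2.symm
  univ := by
    ext1 f
    apply Lp.ext
    filter_upwards [indicatorProj_apply ⟨Set.univ, MeasurableSet.univ⟩ f] with x h1
    rw [h1]
    simp
  inter E F := by
    ext1 f
    exact (indicatorProj_comp E F f).symm
  iUnion E hE f := by
    have hint : Integrable (fun x => ‖f x‖ ^ 2) α :=
      (memLp_two_iff_integrable_sq_norm (Lp.aestronglyMeasurable f)).1 (Lp.memLp f)
    have h1 := hasSum_integral_iUnion (fun n => (E n).2) hE hint.integrableOn
    rw [HasSum, ← tendsto_sub_nhds_zero_iff] at h1 ⊢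
    rw [tendsto_zero_iff_norm_tendsto_zero]
    have h2 : ∀ s : Finset ℕ, ‖∑ n ∈ s, indicatorProj α K (E n) f
        - indicatorProj α K ⟨⋃ n, (E n).1, MeasurableSet.iUnion fun n => (E n).2⟩ f‖
        = Real.sqrt (-(∑ n ∈ s, ∫ x in (E n).1, ‖f x‖ ^ 2 ∂α
          - ∫ x in ⋃ n, (E n).1, ‖f x‖ ^ 2 ∂α)) := by
      intro s
      rw [norm_sub_rev, indicatorProj_sub_sum hE, ← Real.sqrt_sq (norm_nonneg _),
        norm_indicatorProj_sq, setIntegral_sdiff (s.measurableSet_biUnion fun n _ => (E n).2)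
          hint.integrableOn (by
            exact Set.iUnion₂_subset fun n _ => Set.subset_iUnion (fun n => (E n).1) n),
        integral_biUnion_finset s (fun n _ => (E n).2) (fun i _ j _ hij => hE hij)
          fun n _ => hint.integrableOn, neg_sub]
    simp_rw [h2]
    have h3 := (Real.continuous_sqrt.comp continuous_neg).tendsto (0 : ℝ)
    simp only [Function.comp_apply, neg_zero, Real.sqrt_zero] at h3
    exact h3.comp h1

end Projection

/-! ### A jointly measurable density on `G × X` -/

section JointDensity

variable {G X : Type*} [Group G] [MeasurableSpace G] [MeasurableInv G] [MeasurableSpace X]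
  [MulAction G X] [MeasurableSMul₂ G X]

/-- The transformation `(g, x) ↦ (g, g⁻¹ x)`. -/
def shearInvSMul (G X : Type*) [Group G] [MeasurableSpace G] [MeasurableInv G] [MeasurableSpace X]
    [MulAction G X] [MeasurableSMul₂ G X] : G × X ≃ᵐ G × X where
  toFun p := (p.1, p.1⁻¹ • p.2)
  invFun p := (p.1, p.1 • p.2)
  left_inv p := by simp
  right_inv p := by simp
  measurable_toFun := measurable_fst.prodMk (measurable_fst.inv.smul measurable_snd)
  measurable_invFun := measurable_fst.prodMk (measurable_fst.smul measurable_snd)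

variable (μ : Measure G) [SigmaFinite μ] {α : Measure X} [SigmaFinite α]

omit [SigmaFinite μ] in
-- By Fubini it suffices to look at sections over fixed `g`, where this is the invariance of the
-- measure class.
theorem prod_absolutelyContinuous_map_shearInvSMul (hα : HasInvariantClass G α) :
    μ.prod α ≪ (μ.prod α).map (shearInvSMul G X) := by
  refine Measure.AbsolutelyContinuous.mk fun s hs h => ?_
  rw [MeasurableEquiv.map_apply,
    Measure.measure_prod_null ((shearInvSMul G X).measurable hs)] at h
  rw [Measure.measure_prod_null hs]
  filter_upwards [h] with g hg
  have h1 := hα g hg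
  rw [Measure.map_apply (measurable_const_smul g)
    (measurable_prodMk_left ((shearInvSMul G X).measurable hs))] at h1
  simpa [shearInvSMul, Set.preimage_preimage] using h1

/-- A jointly measurable function whose sections satisfy, for almost every `g`, the
change of variables formula of the density of `α` with respect to its translate by `g⁻¹`. -/
theorem exists_joint_density (hα : HasInvariantClass G α) :
    ∃ R : G × X → ENNReal, Measurable R ∧ ∀ f : X → ENNReal, Measurable f →
      ∀ᵐ g ∂μ, ∫⁻ x, f x ∂(α.map (fun x => g⁻¹ • x)).withDensity (fun x => R (g, x))
        = ∫⁻ x, f x ∂α := by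
  set Φ := shearInvSMul G X
  have : SigmaFinite ((μ.prod α).map Φ) := Φ.sigmaFinite_map
  set R := (μ.prod α).rnDeriv ((μ.prod α).map Φ)
  have hR : Measurable R := Measure.measurable_rnDeriv _ _
  refine ⟨R, hR, fun f hf => ?_⟩
  have h1 : ((μ.prod α).map Φ).withDensity R = μ.prod α :=
    Measure.withDensity_rnDeriv_eq _ _ (prod_absolutelyContinuous_map_shearInvSMul μ hα)
  have h2 : ∀ g, ∫⁻ x, f x ∂(α.map (fun x => g⁻¹ • x)).withDensity (fun x => R (g, x))
      = ∫⁻ x, R (Φ (g, x)) * f (Φ (g, x)).2 ∂α := by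
    intro g
    have hR' : Measurable fun x => R (g, x) := hR.comp measurable_prodMk_left
    rw [lintegral_withDensity_eq_lintegral_mul _ hR' hf,
      lintegral_map (hR'.mul hf) (measurable_const_smul g⁻¹)]
    rfl
  simp_rw [h2]
  have hm : Measurable fun p => R (Φ p) * f (Φ p).2 :=
    (hR.comp Φ.measurable).mul (hf.comp (measurable_snd.comp Φ.measurable))
  -- The shear fixes the `G`-coordinate, so testing the product density on `1_A(g) f(x)` compares
  -- the two functions of `g` over every `A`.
  refine ae_eq_of_forall_setLIntegral_eq_of_sigmaFinite hm.lintegral_prod_right'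
    measurable_const fun A hA _ => ?_
  have hA' : Measurable (A.indicator (fun _ => (1 : ENNReal))) := measurable_const.indicator hA
  have hm1 : Measurable fun p : G × X => A.indicator (fun _ => (1 : ENNReal)) p.1 * f p.2 :=
    (hA'.comp measurable_fst).mul (hf.comp measurable_snd)
  have hm2 : Measurable fun p : G × X =>
      A.indicator (fun _ => (1 : ENNReal)) p.1 * (R (Φ p) * f (Φ p).2) :=
    (hA'.comp measurable_fst).mul hm
  have h3 : ∫⁻ p, A.indicator (fun _ => (1 : ENNReal)) p.1 * f p.2 ∂(μ.prod α)
      = ∫⁻ p, A.indicator (fun _ => (1 : ENNReal)) p.1 * (R (Φ p) * f (Φ p).2) ∂(μ.prod α) := by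
    conv_lhs => rw [← h1]
    rw [lintegral_withDensity_eq_lintegral_mul _ hR hm1, lintegral_map_equiv]
    refine lintegral_congr fun p => ?_
    change R (Φ p) * (A.indicator (fun _ => (1 : ENNReal)) p.1 * f (Φ p).2) = _
    ring
  rw [lintegral_prod _ hm1.aemeasurable, lintegral_prod _ hm2.aemeasurable] at h3
  rw [← lintegral_indicator hA, ← lintegral_indicator hA]
  have h4 : ∀ F : G → ENNReal, A.indicator F
      = fun g => A.indicator (fun _ => (1 : ENNReal)) g * F g := by
    intro F
    ext g
    by_cases hg : g ∈ A <;> simp [hg]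
  have h5 : ∀ g, A.indicator (fun g => ∫⁻ x, R (Φ (g, x)) * f (Φ (g, x)).2 ∂α) g
      = ∫⁻ x, A.indicator (fun _ => (1 : ENNReal)) g * (R (Φ (g, x)) * f (Φ (g, x)).2) ∂α :=
    fun g => (congrFun (h4 _) g).trans
      (lintegral_const_mul _ (hm.comp measurable_prodMk_left)).symm
  have h6 : ∀ g, A.indicator (fun _ => ∫⁻ x, f x ∂α) g
      = ∫⁻ x, A.indicator (fun _ => (1 : ENNReal)) g * f x ∂α :=
    fun g => (congrFun (h4 _) g).trans (lintegral_const_mul _ hf).symm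
  rw [lintegral_congr h5, lintegral_congr h6]
  exact h3.symm

end JointDensity

/-! ### Recovering a measure from the norms of a dense family -/

section Dense

variable {X : Type*} [MeasurableSpace X] {α γ : Measure X}
  {K : Type*} [NormedAddCommGroup K]

/-- Fatou's lemma along an almost everywhere convergent subsequence gives `≤` for all `f`. That
bound controls the approximation error in the `γ`-norm, and the triangle inequality then gives `≥`.
-/
theorem eLpNorm_eq_of_dense {ι : Type*} {d : ι → Lp K 2 α} (hd : DenseRange d) (hγ : γ ≪ α)
    (h : ∀ i, eLpNorm (d i) 2 γ = eLpNorm (d i) 2 α) (f : Lp K 2 α) :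
    eLpNorm f 2 γ = eLpNorm f 2 α := by
  have hle : ∀ f : Lp K 2 α, eLpNorm f 2 γ ≤ eLpNorm f 2 α := by
    intro f
    obtain ⟨a, ha, hlim⟩ := mem_closure_iff_seq_limit.1 (hd f)
    choose i hi using ha
    obtain ⟨ns, hns, hae⟩ := (tendstoInMeasure_of_tendsto_Lp hlim).exists_seq_tendsto_ae
    refine (Lp.eLpNorm_lim_le_liminf_eLpNorm
      (fun n => ((Lp.aestronglyMeasurable (a (ns n))).mono_ac hγ)) f
      (hγ.ae_le hae)).trans ?_
    have h1 : ∀ n, eLpNorm (a (ns n)) 2 γ = ‖a (ns n)‖ₑ := fun n => by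
      rw [← hi, h, Lp.enorm_def]
    simp_rw [h1, ← Lp.enorm_def]
    exact ((continuous_enorm.tendsto f).comp (hlim.comp hns.tendsto_atTop)).liminf_eq.le
  refine le_antisymm (hle f) (ENNReal.le_of_forall_pos_le_add fun ε hε _ => ?_)
  obtain ⟨i, hi⟩ := hd.exists_dist_lt f (half_pos (NNReal.coe_pos.2 hε))
  have h1 : eLpNorm (f - d i : Lp K 2 α) 2 α ≤ ENNReal.ofReal (ε / 2) := by
    rw [← Lp.enorm_def, ← ofReal_norm, ← dist_eq_norm]
    exact ENNReal.ofReal_le_ofReal hi.le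
  have htri : ∀ (ν : Measure X) (_ : ν ≪ α) (f g : Lp K 2 α),
      eLpNorm f 2 ν ≤ eLpNorm g 2 ν + eLpNorm (f - g : Lp K 2 α) 2 ν := by
    intro ν hν f g
    have h2 : (f : X → K) =ᵐ[ν] (g : X → K) + ((f - g : Lp K 2 α) : X → K) := by
      filter_upwards [hν.ae_le (Lp.coeFn_sub f g)] with x hx
      rw [Pi.add_apply, hx, Pi.sub_apply, add_sub_cancel]
    rw [eLpNorm_congr_ae h2]
    exact eLpNorm_add_le ((Lp.aestronglyMeasurable g).mono_ac hν)
      ((Lp.aestronglyMeasurable _).mono_ac hν) (by norm_num)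
  have h3 : eLpNorm (d i - f : Lp K 2 α) 2 α ≤ ENNReal.ofReal (ε / 2) := by
    rw [← Lp.enorm_def, ← ofReal_norm, ← dist_eq_norm, dist_comm]
    exact ENNReal.ofReal_le_ofReal hi.le
  calc eLpNorm f 2 α ≤ eLpNorm (d i) 2 α + ENNReal.ofReal (ε / 2) :=
        (htri α .rfl f (d i)).trans (by gcongr)
    _ = eLpNorm (d i) 2 γ + ENNReal.ofReal (ε / 2) := by rw [h]
    _ ≤ eLpNorm f 2 γ + ENNReal.ofReal (ε / 2) + ENNReal.ofReal (ε / 2) := by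
        gcongr
        exact (htri γ hγ (d i) f).trans (by gcongr; exact (hle _).trans h3)
    _ = eLpNorm f 2 γ + ε := by
        rw [add_assoc, ← ENNReal.ofReal_add (by positivity) (by positivity), add_halves,
          ENNReal.ofReal_coe_nnreal]

/-- A measure for which a dense sequence of `L²(α)` has the same `L²` norms as for `α` is `α`. -/
theorem measure_eq_of_dense [Nontrivial K] [SigmaFinite α] {ι : Type*} {d : ι → Lp K 2 α}
    (hd : DenseRange d) (hγ : γ ≪ α) (h : ∀ i, eLpNorm (d i) 2 γ = eLpNorm (d i) 2 α) :
    γ = α := by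
  obtain ⟨c, hc⟩ := exists_ne (0 : K)
  have hfin : ∀ E, MeasurableSet E → α E ≠ ⊤ → γ E = α E := by
    intro E hE hE'
    have h1 := eLpNorm_eq_of_dense hd hγ h (indicatorConstLp 2 hE hE' c)
    rw [eLpNorm_congr_ae (hγ.ae_le indicatorConstLp_coeFn), eLpNorm_congr_ae indicatorConstLp_coeFn,
      eLpNorm_indicator_const hE (by simp) (by simp),
      eLpNorm_indicator_const hE (by simp) (by simp),
      ENNReal.mul_right_inj (by simpa using hc) (by simp)] at h1
    exact ENNReal.rpow_left_injective (by simp) h1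
  ext E hE
  have hu : E = ⋃ n, E ∩ spanningSets α n := by
    rw [← Set.inter_iUnion, iUnion_spanningSets, Set.inter_univ]
  have hmono : Monotone fun n => E ∩ spanningSets α n := fun i j hij =>
    Set.inter_subset_inter_right _ (monotone_spanningSets α hij)
  rw [hu, hmono.measure_iUnion, hmono.measure_iUnion]
  congr 1
  ext1 n
  exact hfin _ (hE.inter (measurableSet_spanningSets α n))
    ((measure_mono Set.inter_subset_right).trans_lt (measure_spanningSets_lt_top α n)).ne

end Dense

/-! ### Measurability of the operators attached to a cocycle -/

section Measurability

variable {G X : Type*} [Group G] [MeasurableSpace G] [MeasurableInv G] [MeasurableSpace X]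
  [MulAction G X] [MeasurableSMul₂ G X] (μ : Measure G) [SigmaFinite μ] {α : Measure X}
  [SigmaFinite α] {K : Type*} [NormedAddCommGroup K] [InnerProductSpace ℂ K]
  {r : G → X → NNReal}

omit [MeasurableInv G] [SigmaFinite α] in
theorem IsRadonNikodymFamily.isTransferWeight (hr : IsRadonNikodymFamily α r)
    (hα : HasInvariantClass G α) (g : G) :
    IsTransferWeight (MeasurableEquiv.smul g) α α (r g) :=
  ⟨(hr g).1, (hr g).2, hα g⁻¹⟩

/-- Radon–Nikodym derivatives of the translates of `α` can be chosen jointly measurable, up to a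
null set of group elements. -/
theorem exists_joint_radonNikodym (K : Type*) [NormedAddCommGroup K] [Nontrivial K]
    [TopologicalSpace.SeparableSpace (Lp K 2 α)]
    (hα : HasInvariantClass G α) (hr : IsRadonNikodymFamily α r) :
    ∃ R : G × X → NNReal, Measurable R ∧ ∀ᵐ g ∂μ, r g =ᵐ[α] fun x => R (g, x) := by
  obtain ⟨R, hR, hRf⟩ := exists_joint_density μ hα
  refine ⟨fun p => (R p).toNNReal, hR.ennreal_toNNReal, ?_⟩
  let d := TopologicalSpace.denseSeq (Lp K 2 α)
  -- The exceptional set of `g` depends on the test function. Countably many, the squared norms of a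
  -- dense sequence of `L²`, already determine the measure.
  filter_upwards [ae_all_iff.2 fun n =>
    hRf (fun x => ‖d n x‖ₑ ^ 2) ((Lp.stronglyMeasurable (d n)).enorm.pow_const 2)] with g hg
  have hRg : Measurable fun x => R (g, x) := hR.comp measurable_prodMk_left
  have h1 : (α.map (fun x => g⁻¹ • x)).withDensity (fun x => R (g, x)) = α :=
    measure_eq_of_dense (TopologicalSpace.denseRange_denseSeq (Lp K 2 α))
      ((withDensity_absolutelyContinuous _ _).trans (hα g⁻¹)) fun n => by
        rw [eLpNorm_two_eq_lintegral, eLpNorm_two_eq_lintegral, hg n]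
  have : SigmaFinite (α.map fun x => g⁻¹ • x) :=
    (MeasurableEquiv.smul g⁻¹ : X ≃ᵐ X).sigmaFinite_map
  have h2 := (hr g).2.symm.trans h1.symm
  rw [withDensity_eq_iff_of_sigmaFinite (hr g).1.coe_nnreal_ennreal.aemeasurable
    hRg.aemeasurable] at h2
  filter_upwards [(hr.isTransferWeight hα g).absolutelyContinuous.ae_le h2] with x hx
  rw [← hx, ENNReal.toNNReal_coe]

theorem aemeasurable_of_isWeightedComp [CompleteSpace K] [TopologicalSpace.SeparableSpace K]
    [TopologicalSpace.SeparableSpace (Lp K 2 α)]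
    (hα : HasInvariantClass G α) (hr : IsRadonNikodymFamily α r)
    {φ : G × X → K ≃ₗᵢ[ℂ] K} (hφ : Measurable φ) {V : G → Lp K 2 α ≃ₗᵢ[ℂ] Lp K 2 α}
    (hV : ∀ g, IsWeightedComp (MeasurableEquiv.smul g) (r g) (fun x => φ (g, x)) (V g)) :
    AEMeasurable V μ := by
  refine aemeasurable_unitary_of_inner fun f f' => ?_
  -- If `K = 0`, norms in `L²` carry no information about `α`, but all coefficients vanish.
  rcases subsingleton_or_nontrivial K with hK | hK
  · have : ∀ g, (inner ℂ f (V g f') : ℂ) = 0 := fun g => by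
      rw [L2.inner_def]
      simp [Subsingleton.elim _ (0 : K)]
    simp [this]
  obtain ⟨R, hR, hRr⟩ := exists_joint_radonNikodym μ K hα hr
  have hmeas : StronglyMeasurable fun p : G × X => (inner ℂ (f p.2)
      (((Real.sqrt (R (p.1, p.1⁻¹ • p.2)) : ℝ) : ℂ) •
        φ (p.1, p.1⁻¹ • p.2) (f' (p.1⁻¹ • p.2))) : ℂ) := by
    have hs : Measurable fun p : G × X => (p.1, p.1⁻¹ • p.2) := (shearInvSMul G X).measurable
    refine ((Lp.stronglyMeasurable f).comp_measurable measurable_snd).inner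
      (StronglyMeasurable.smul ?_ ?_)
    · exact (Complex.measurable_ofReal.comp
        (hR.comp hs).coe_nnreal_real.sqrt).stronglyMeasurable
    · exact stronglyMeasurable_unitary_apply (hφ.comp hs)
        ((Lp.stronglyMeasurable f').comp_measurable (measurable_snd.comp hs))
  refine ⟨_, (hmeas.integral_prod_right' (ν := α)).measurable, ?_⟩
  filter_upwards [hRr] with g hg
  rw [L2.inner_def]
  refine integral_congr_ae ?_
  have h1 := (hV g).congr (hr.isTransferWeight hα g).quasiMeasurePreserving_symm hg
    (EventuallyEq.refl _ _)
  filter_upwards [h1 f'] with x hx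
  rw [hx]
  rfl

end Measurability

/-! ### Operators attached to a cocycle -/

section SystemOfImprimitivity

variable {G : Type*} [Group G] [MeasurableSpace G] {μ : Measure G} [SigmaFinite μ]
  {X : Type*} [MeasurableSpace X] [MulAction G X] [MeasurableSMul₂ G X]
  {K : Type*} [NormedAddCommGroup K] [InnerProductSpace ℂ K]
  {m : G → G → Circle} {α : Measure X} [SigmaFinite α] {r : G → X → NNReal}
  {φ : G × X → K ≃ₗᵢ[ℂ] K}

/-- The operators attached to a cocycle are almost everywhere multiplicative, up to the
multiplier. -/
theorem IsWeightedComp.ae_map_mul (hα : HasInvariantClass G α) (hr : IsRadonNikodymFamily α r)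
    (hφ : IsMCocycle μ m α φ) {V : G → Lp K 2 α ≃ₗᵢ[ℂ] Lp K 2 α}
    (hV : ∀ g, IsWeightedComp (MeasurableEquiv.smul g) (r g) (fun x => φ (g, x)) (V g)) :
    ∀ᵐ a ∂μ, ∀ᵐ b ∂μ, ∀ v, V (a * b) v = (m a b : ℂ) • V a (V b v) := by
  filter_upwards [Measure.ae_ae_of_ae_prod hφ.map_mul] with a ha
  filter_upwards [Measure.ae_ae_of_ae_prod ha] with b hb
  have hT : (MeasurableEquiv.smul b).trans (MeasurableEquiv.smul a)
      = (MeasurableEquiv.smul (a * b) : X ≃ᵐ X) := by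
    ext x
    exact (mul_smul a b x).symm
  have hab := hr.isTransferWeight hα (a * b)
  have h1 := ((hV b).trans (hV a)
    (hr.isTransferWeight hα a).quasiMeasurePreserving_symm).circleSMul (m a b)
  -- The product `r_a(b x) r_b(x)` is a weight for `ab`, hence agrees with `r_{ab}` almost
  -- everywhere.
  have h2 := (hr.isTransferWeight hα b).trans (hr.isTransferWeight hα a)
  rw [hT] at h1 h2
  refine fun v => congrFun ((hV (a * b)).unique (h1.congr hab.quasiMeasurePreserving_symm
    (h2.ae_eq hab) ?_)) v
  filter_upwards [hb] with x hx
  ext k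
  exact (hx k).symm

variable [CompleteSpace K]

omit [SigmaFinite μ] [SigmaFinite α] in
theorem IsGivenByCocycle.isWeightedComp {S : MSystemOfImprimitivity m X (Lp K 2 α)}
    (hS : IsGivenByCocycle μ α r φ S) :
    ∀ᵐ g ∂μ, IsWeightedComp (MeasurableEquiv.smul g) (r g) (fun x => φ (g, x)) (S.U g) :=
  hS.repr

omit [SigmaFinite μ] [SigmaFinite α] in
theorem IsGivenByCocycle.proj_eq {S : MSystemOfImprimitivity m X (Lp K 2 α)}
    (hS : IsGivenByCocycle μ α r φ S) : S.P = indicatorProj α K := by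
  ext1 E
  ext1 f
  exact Lp.ext ((hS.proj E f).trans (indicatorProj_apply E f).symm)

omit [CompleteSpace K] [SigmaFinite α] in
theorem IsWeightedComp.indicatorProj_smul (hα : HasInvariantClass G α)
    (hr : IsRadonNikodymFamily α r) {g : G} {V : Lp K 2 α ≃ₗᵢ[ℂ] Lp K 2 α}
    (hV : IsWeightedComp (MeasurableEquiv.smul g) (r g) (fun x => φ (g, x)) V)
    (E : BorelSubset X) (f : Lp K 2 α) :
    V (indicatorProj α K E f) = indicatorProj α K (E.translate g) (V f) :=
  Lp.ext ((hV.indicator (hr.isTransferWeight hα g).quasiMeasurePreserving_symm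
    (indicatorProj_apply E f)).trans (indicatorProj_apply (E.translate g) (V f)).symm)

end SystemOfImprimitivity

/-! ### Existence, uniqueness and equivalence -/

section Main

variable {G : Type*} [Group G] [TopologicalSpace G] [IsTopologicalGroup G]
  [SecondCountableTopology G] [MeasurableSpace G] [BorelSpace G]
  {μ : Measure G} [μ.IsMulLeftInvariant] [SigmaFinite μ] [NeZero μ]
  {X : Type*} [MeasurableSpace X] [MulAction G X] [MeasurableSMul₂ G X]
  {K : Type*} [NormedAddCommGroup K] [InnerProductSpace ℂ K] [CompleteSpace K]
  {m : G → G → Circle} {α : Measure X} [SigmaFinite α] {r : G → X → NNReal}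
  {φ : G × X → K ≃ₗᵢ[ℂ] K}

theorem exists_isGivenByCocycle [TopologicalSpace.SeparableSpace K]
    [TopologicalSpace.SeparableSpace (Lp K 2 α)] (hm : IsMultiplier m)
    (hα : HasInvariantClass G α) (hr : IsRadonNikodymFamily α r) (hφ : IsMCocycle μ m α φ) :
    ∃ S : MSystemOfImprimitivity m X (Lp K 2 α), IsGivenByCocycle μ α r φ S := by
  have hex : ∀ g, ∃ V : Lp K 2 α ≃ₗᵢ[ℂ] Lp K 2 α,
      IsWeightedComp (MeasurableEquiv.smul g) (r g) (fun x => φ (g, x)) V := fun g =>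
    exists_isWeightedComp (hr.isTransferWeight hα g) (hφ.measurable.comp measurable_prodMk_left)
  choose V hV using hex
  obtain ⟨U, hU, hUV, hUprod⟩ := exists_mRepresentation_of_ae μ hm
    (IsWeightedComp.ae_map_mul hα hr hφ hV)
  have hUm : Measurable U := measurable_mRepresentation μ hm hU
    ((aemeasurable_of_isWeightedComp μ hα hr hφ.measurable hV).congr
      (hUV.mono fun _ h => h.symm))
  refine ⟨⟨U, indicatorProj α K, ⟨hUm, hU⟩, isProjectionValuedMeasure_indicatorProj, ?_⟩,
    indicatorProj_apply, hUV.mono fun g hg => ?_⟩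
  · intro g E v
    obtain ⟨v, rfl⟩ := (U g).surjective v
    rw [LinearIsometryEquiv.inv_def, LinearIsometryEquiv.symm_apply_apply]
    -- `U g` has the explicit formula only for almost all `g`, but it is always a scalar times `V a
    -- V b`, and both factors translate the projections.
    obtain ⟨a, b, hab, h⟩ := hUprod g
    have htr : E.translate g = (E.translate b).translate a := by
      apply Subtype.ext
      simp only [BorelSubset.translate, Set.image_image, smul_smul, hab]
    rw [h, h, (hV b).indicatorProj_smul hα hr, (hV a).indicatorProj_smul hα hr, map_smul, htr]
  · have h := hV g
    rw [← hg] at h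
    exact h

omit [SecondCountableTopology G] [SigmaFinite μ] [SigmaFinite α] in
theorem IsGivenByCocycle.unique {S S' : MSystemOfImprimitivity m X (Lp K 2 α)}
    (hS : IsGivenByCocycle μ α r φ S) (hS' : IsGivenByCocycle μ α r φ S') : S = S' := by
  have hP : S.P = S'.P := hS.proj_eq.trans hS'.proj_eq.symm
  have hU : S.U = S'.U := by
    refine mRepresentation_ext_ae μ S.isMRepresentation.map_mul S'.isMRepresentation.map_mul ?_
    filter_upwards [hS.isWeightedComp, hS'.isWeightedComp] with g h h'
    exact DFunLike.coe_injective (h.unique h')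
  cases S
  cases S'
  cases hP
  cases hU
  rfl

omit [SecondCountableTopology G] [SigmaFinite μ] in
/-- Cocycles that are cohomologous relative to the same measure class give equivalent systems. -/
theorem IsGivenByCocycle.equivalent [TopologicalSpace.SeparableSpace K]
    (hα : HasInvariantClass G α) (hr : IsRadonNikodymFamily α r)
    {α' : Measure X} [SigmaFinite α'] (hα' : α' ≪ α) (hα'' : α ≪ α')
    {r' : G → X → NNReal} (hr' : IsRadonNikodymFamily α' r')
    {φ' : G × X → K ≃ₗᵢ[ℂ] K} (hφ : Cohomologous μ α φ φ')
    {S : MSystemOfImprimitivity m X (Lp K 2 α)} {S' : MSystemOfImprimitivity m X (Lp K 2 α')}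
    (hS : IsGivenByCocycle μ α r φ S) (hS' : IsGivenByCocycle μ α' r' φ' S') :
    S.Equivalent S' := by
  obtain ⟨b, hb, hbφ⟩ := hφ
  have hinv' : HasInvariantClass G α' := fun g =>
    ((hα'.map (measurable_const_smul g)).trans (hα g)).trans hα''
  have hρ : IsTransferWeight (MeasurableEquiv.refl X) α α' fun x => (α.rnDeriv α' x).toNNReal := by
    have hmap : α'.map (MeasurableEquiv.refl X).symm = α' := Measure.map_id
    refine ⟨(Measure.measurable_rnDeriv _ _).ennreal_toNNReal, ?_, by rwa [hmap]⟩
    rw [hmap]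
    conv_lhs => rw [← Measure.withDensity_rnDeriv_eq α α' hα'']
    refine withDensity_congr_ae ?_
    filter_upwards [Measure.rnDeriv_lt_top α α'] with x hx
    rw [ENNReal.coe_toNNReal hx.ne]
  -- `W` is multiplication by `(dα/dα')^{1/2} b`.
  obtain ⟨W, hW⟩ := exists_isWeightedComp (K := K) hρ hb
  have hconj : (fun g => W.symm.trans ((S.U g).trans W)) = S'.U := by
    refine mRepresentation_ext_ae μ (fun g g' v => ?_) S'.isMRepresentation.map_mul ?_
    · simp [S.isMRepresentation.map_mul]
    · filter_upwards [hS.isWeightedComp, hS'.isWeightedComp, Measure.ae_ae_of_ae_prod hbφ]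
        with g h h' hg
      have hg1 := hr.isTransferWeight hα g
      have hg2 := hr'.isTransferWeight hinv' g
      have h1 := h.trans hW hρ.quasiMeasurePreserving_symm
      have h2 := hW.trans h' hg2.quasiMeasurePreserving_symm
      have h3 : (fun f => W (S.U g f)) = fun f => S'.U g (W f) := by
        -- Both composites carry a density of `α` against the pullback of `α'` by `g`, so the
        -- weights agree. The unitary parts agree by the cohomology relation.
        refine h1.unique (h2.congr (hρ.trans hg2).quasiMeasurePreserving_symm
          ((hρ.trans hg2).ae_eq (hg1.trans hρ)) ?_)
        filter_upwards [hg] with x hx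
        change φ' (g, x) * b x = b (g • x) * φ (g, x)
        rw [hx, inv_mul_cancel_right]
      ext1 f
      have h4 := congrFun h3 (W.symm f)
      simpa using h4
  refine ⟨W, fun g v => ?_, fun E v => ?_⟩
  · rw [← hconj]
    simp
  · rw [hS.proj_eq, hS'.proj_eq]
    refine Lp.ext ((hW.indicator hρ.quasiMeasurePreserving_symm (indicatorProj_apply E v)).trans ?_)
    refine EventuallyEq.trans ?_ (indicatorProj_apply E (W v)).symm
    simp

end Main

theorem mainTheorem4
    {G : Type*} [Group G] [TopologicalSpace G] [IsTopologicalGroup G] [T2Space G]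
    [LocallyCompactSpace G] [SecondCountableTopology G] [MeasurableSpace G] [BorelSpace G]
    (μ : Measure G) [μ.IsHaarMeasure]
    {X : Type*} [MeasurableSpace X] [MulAction G X] [MeasurableSMul₂ G X]
    {K : Type*} [NormedAddCommGroup K] [InnerProductSpace ℂ K] [CompleteSpace K]
    [TopologicalSpace.SeparableSpace K]
    (m : G → G → Circle) (hm : IsMultiplier m)
    (α : Measure X) [SigmaFinite α] (hα : HasInvariantClass G α)
    [TopologicalSpace.SeparableSpace (Lp K 2 α)]
    (r : G → X → NNReal) (hr : IsRadonNikodymFamily α r)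
    (φ : G × X → (K ≃ₗᵢ[ℂ] K)) (hφ : IsMCocycle μ m α φ) :
    (∃! S : MSystemOfImprimitivity m X (Lp K 2 α), IsGivenByCocycle μ α r φ S) ∧
    (∀ (α' : Measure X) [SigmaFinite α'], α' ≪ α → α ≪ α' →
      ∀ r' : G → X → NNReal, IsRadonNikodymFamily α' r' →
      ∀ φ' : G × X → (K ≃ₗᵢ[ℂ] K), IsMCocycle μ m α' φ' → Cohomologous μ α φ φ' →
      ∀ (S : MSystemOfImprimitivity m X (Lp K 2 α))
        (S' : MSystemOfImprimitivity m X (Lp K 2 α')),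
        IsGivenByCocycle μ α r φ S → IsGivenByCocycle μ α' r' φ' S' → S.Equivalent S') := by
  refine ⟨?_, ?_⟩
  · obtain ⟨S, hS⟩ := exists_isGivenByCocycle hm hα hr hφ
    exact ⟨S, hS, fun S' hS' => hS'.unique hS⟩
  · intro α' _ hα' hα'' r' hr' φ' _ hcoh S S' hS hS'
    exact hS.equivalent hα hr hα' hα'' hr' hcoh hS'
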